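/- **Theorem (Representation Learning for Adversarial Robustness).** For a classifier $f:\mathbb R^2\to\{0,1\}$ and a distribution $P$ on $\mathbb R^2\times\{0,1\}$, let $R(f;P)=P[f(x)\ne y]$ be the natural error, and for $\gamma\ge 0$ let $R_{\mathrm{Adv},\gamma}(f;P)=P[\exists z,\ \|z-x\|_2\le\gamma,\ f(z)\ne y]$ be the $\gamma$-adversarial error. A classifier *perfectly fits* a sample if $f(x_i)=y_i$ for all its points. A *linear classifier* is $x\mapsto \mathbf 1[w^\top x+w_0>0]$ with $w\in\mathbb R^2$, $w_0\in\mathbb R$. There is a universal constant $c>0$ such that for every $0<\gamma_0<1/\sqrt2$ there are a lattice spacing $L>0$, a radius $0<r<L/2$ and a family of distributions $(P_{k,s})_{k\ge 2,\ s\in\{0,1\}}$ on $\mathbb R^2\times\{0,1\}$ of the following form. There is a finite set $S\subset\mathbb Z^2$ (depending on $k,s$) with exactly $k$ pairs $(a,b)$ with $a+b$ even and exactly $k$ pairs with $a+b$ odd; to draw $(x,y)\sim P_{k,s}$, draw $(a,b)\in S$ uniformly, draw $x$ uniformly from the closed Euclidean ball of radius $r$ around $(La,Lb)$, and put $y=a+b+s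 \bmod 2$. For every $k\ge2$ and $s$, writing $P=P_{k,s}$ and letting $\mathcal S_m$ be the first $m$ terms of an infinite i.i.d. sequence from $P$: 1. Almost surely, all of the following hold. - For every $m\ge 0$, $\mathcal S_m$ is linearly separable: there are $w\in\mathbb R^2$, $w_0\in\mathbb R$ with $(2y_i-1)(w^\top x_i+w_0)>0$ for all $(x_i,y_i)\in\mathcal S_m$. - For every $m\ge 0$, every linear classifier $f$ that perfectly fits $\mathcal S_m$ and every $\gamma>\gamma_0$, $R_{\mathrm{Adv},\gamma}(f;P)\ge 0.0005$. - Nevertheless, for any linear classifiers $f_m$ such that $f_m$ perfectly fits $\mathcal S_m$ for every $m$, $R(f_m;P)\to 0$ as $m\to\infty$. 2. Let $\mathcal H=\{g_0,g_1\}$, where $g_t(x)=[x_1/L]+[x_2/L]+t \bmod 2$ and $[\cdot]$ is rounding to the nearest integer. Almost surely, for every $m$ some $h\in\mathcal H$ perfectly fits $\mathcal S_m$. For every $\delta\in(0,1)$ and every $m\ge c\log(1/\delta)$, with probability at least $1-\delta$, every $h\in\mathcal H$ that perfectly fits $\mathcal S_m$ satisfies $R(h;P)=0$ and $R_{\mathrm{Adv},\gamma}(h;P)=0$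 for all $\gamma\in[0,\gamma_0+1/8]$. -/

import Mathlib

open MeasureTheory Filter Topology
open scoped ENNReal

/-- The Euclidean plane. -/
abbrev Plane : Type := EuclideanSpace ℝ (Fin 2)

/-- Labelled points. The label `1` is `true`, the label `0` is `false`. -/
abbrev LabelledPoint : Type := Plane × Bool

/-- The natural error `P[f(x) ≠ y]`. -/
noncomputable def naturalError (P : Measure LabelledPoint) (f : Plane → Bool) : ℝ :=
  P.real {p | f p.1 ≠ p.2}

/-- The `γ`-adversarial error `P[∃ z ∈ B_γ(x), f(z) ≠ y]`, with the closed Euclidean ball. -/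
noncomputable def adversarialError (γ : ℝ) (P : Measure LabelledPoint) (f : Plane → Bool) : ℝ :=
  P.real {p | ∃ z ∈ Metric.closedBall p.1 γ, f z ≠ p.2}

/-- `f` perfectly fits the sample formed by the first `m` terms of `ω`. -/
def PerfectlyFits (m : ℕ) (ω : ℕ → LabelledPoint) (f : Plane → Bool) : Prop :=
  ∀ i < m, f (ω i).1 = (ω i).2

/-- The sign `2y - 1` of a label `y`. -/
def labelSign (y : Bool) : ℝ := if y then 1 else -1

/-- The first `m` terms of `ω` are (strictly) linearly separable. -/
def LinearlySeparable (m : ℕ) (ω : ℕ → LabelledPoint) : Prop :=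
  ∃ (w : Plane) (w₀ : ℝ), ∀ i < m, 0 < labelSign (ω i).2 * (inner ℝ w (ω i).1 + w₀)

/-- The linear classifiers `x ↦ 1[⟨w, x⟩ + w₀ > 0]`. -/
def linearClassifiers : Set (Plane → Bool) :=
  {f | ∃ (w : Plane) (w₀ : ℝ), ∀ x, f x = true ↔ 0 < inner ℝ w x + w₀}

/-- The point `(L a, L b)` of the square lattice of spacing `L`. -/
noncomputable def latticePoint (L : ℝ) (a : ℤ × ℤ) : Plane := !₂[L * a.1, L * a.2]

/-- The parity of `a + b`, flipped when `s` is `true`. -/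
def parityLabel (s : Bool) (a : ℤ × ℤ) : Bool := xor s (decide (Odd (a.1 + a.2)))

/-- The law of `(x, y)`, where a centre `a ∈ S` is drawn uniformly, `x` is uniform on the ball of
radius `r` about the lattice point of `a`, and `y` is the (possibly flipped) parity of `a`. -/
noncomputable def latticeBallLaw (L r : ℝ) (S : Finset (ℤ × ℤ)) (s : Bool) :
    Measure LabelledPoint :=
  (S.card : ℝ≥0∞)⁻¹ • ∑ a ∈ S,
    (ProbabilityTheory.cond volume (Metric.closedBall (latticePoint L a) r)).map
      (fun x => (x, parityLabel s a))

/-- `P` is the law above for a set of centres with exactly `k` centres of even parity and exactly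
`k` of odd parity. In other words the label is uniform, and given the label, the ball is uniform
among the `k` balls of that label. -/
def IsLatticeParityLaw (L r : ℝ) (k : ℕ) (s : Bool) (P : Measure LabelledPoint) : Prop :=
  ∃ S : Finset (ℤ × ℤ),
    (S.filter (fun a => Even (a.1 + a.2))).card = k ∧
    (S.filter (fun a => Odd (a.1 + a.2))).card = k ∧
    P = latticeBallLaw L r S s

/-- The two classifiers that answer with the parity of the lattice point obtained by rounding the
coordinates, or with its negation. -/
noncomputable def parityClassifiers (L : ℝ) : Set (Plane → Bool) :=
  {g | ∃ s : Bool, ∀ x, g x = parityLabel s (round (x 0 / L), round (x 1 / L))}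

/-- The law of an infinite sequence of i.i.d. draws from `P`. -/
noncomputable def iidLaw (P : ProbabilityMeasure LabelledPoint) : Measure (ℕ → LabelledPoint) :=
  Measure.infinitePi (fun _ : ℕ => (P : Measure LabelledPoint))

/-! The construction takes spacing 4, an odd `q ≥ 5` with `3 / q ≤ γ₀`, radius `1 / q`, and centres
alternating in parity between the adjacent lattice lines `a + qb = 0` and `a + qb = 1`. A line
midway separates the balls, but the strip is so thin that any linear classifier comes close to an
error: an odd centre lies only `4 / q` above the segment joining two even centres, so moving the
even ones up and the odd one down by `2 / q` makes them collinear, and half-planes are convex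
(`exists_strip_near_error`). Disjoint triples of centres then give adversarial error at least 1/8
(`le_adversarialError_strip`).

Natural error still vanishes: samples become dense in every ball, so each point of an open ball is
eventually in the convex hull of samples with its label, where the classifier must be right
(`ae_tendsto_naturalError_zero`). Rounding is constant within distance 2 of a lattice point, so one
sample identifies the right parity classifier, which is robust (`errors_parity_eq_zero`). -/

/-! ### Convexity and i.i.d. sequences -/

/-- An open set in the closure of `D` is contained in the convex hull of `D`. -/
lemma IsOpen.subset_convexHull_of_subset_closure {E : Type*} [NormedAddCommGroup E]
    [NormedSpace ℝ E] [FiniteDimensional ℝ E] {U D : Set E} (hU : IsOpen U) (h : U ⊆ closure D) :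
    U ⊆ convexHull ℝ D := by
  rcases U.eq_empty_or_nonempty with rfl | hne
  · exact Set.empty_subset _
  have hcl : closure D ⊆ affineSpan ℝ D :=
    closure_minimal (subset_affineSpan ℝ D) (AffineSubspace.closed_of_finiteDimensional _)
  have hspan : affineSpan ℝ D = ⊤ := by
    have h1 : affineSpan ℝ U ≤ affineSpan ℝ D := affineSpan_le.2 (h.trans hcl)
    rw [hU.affineSpan_eq_top hne] at h1
    exact top_le_iff.1 h1
  have hint := interior_convexHull_nonempty_iff_affineSpan_eq_top.2 hspan
  have h2 : U ⊆ interior (closure (convexHull ℝ D)) :=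
    hU.subset_interior_iff.2 (h.trans (closure_mono (subset_convexHull ℝ D)))
  -- Passing to the closure adds no interior to a convex set with nonempty interior, hence the
  -- detour through the affine span.
  rw [(convex_convexHull ℝ D).interior_closure_eq_interior_of_nonempty_interior hint] at h2
  exact h2.trans interior_subset

/-- An i.i.d. sequence almost surely visits every given set of positive probability. -/
lemma ae_exists_mem_infinitePi {X : Type*} [MeasurableSpace X] (P : Measure X)
    [IsProbabilityMeasure P] {A : Set X} (hA : MeasurableSet A) (hpos : 0 < P A) :
    ∀ᵐ ω ∂(Measure.infinitePi fun _ : ℕ => P), ∃ i, ω i ∈ A := by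
  have hlt : P Aᶜ < 1 := by
    rw [prob_compl_eq_one_sub hA]
    exact ENNReal.sub_lt_self ENNReal.one_ne_top one_ne_zero hpos.ne'
  rw [ae_iff]
  -- Missing `A` forever is at most as likely as missing it `m` times, for every `m`.
  refine le_antisymm (ge_of_tendsto' (ENNReal.tendsto_pow_atTop_nhds_zero_of_lt_one hlt)
    fun m => ?_) zero_le
  calc _ ≤ (Measure.infinitePi fun _ : ℕ => P)
        ((Finset.range m : Set ℕ).pi fun _ => Aᶜ) := by
        refine measure_mono fun ω hω i _ hi => hω ⟨i, hi⟩
    _ = P Aᶜ ^ m := by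
        rw [Measure.infinitePi_pi _ fun _ _ => hA.compl]; simp

/-- All terms of an i.i.d. sequence satisfy almost surely what holds almost everywhere. -/
lemma ae_forall_infinitePi {X : Type*} [MeasurableSpace X] (P : Measure X)
    [IsProbabilityMeasure P] {p : X → Prop} (h : ∀ᵐ x ∂P, p x) :
    ∀ᵐ ω ∂(Measure.infinitePi fun _ : ℕ => P), ∀ i, p (ω i) :=
  ae_all_iff.2 fun i =>
    (measurePreserving_eval_infinitePi (fun _ : ℕ => P) i).quasiMeasurePreserving.ae h

/-! ### Linear classifiers -/

lemma linearClassifiers_convex {f : Plane → Bool} (hf : f ∈ linearClassifiers) (b : Bool) :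
    Convex ℝ {x | f x = b} := by
  obtain ⟨w, w₀, hf⟩ := hf
  have hl : IsLinearMap ℝ fun x : Plane => inner ℝ w x :=
    ⟨fun x y => inner_add_right _ _ _, fun c x => inner_smul_right _ _ _⟩
  cases b
  · have h : {x | f x = false} = {x : Plane | inner ℝ w x ≤ -w₀} := by
      ext x
      change f x = false ↔ inner ℝ w x ≤ -w₀
      rw [← Bool.not_eq_true, hf x, not_lt, ← le_neg_iff_add_nonpos_right]
    exact h ▸ convex_halfSpace_le hl (-w₀)
  · have h : {x | f x = true} = {x : Plane | -w₀ < inner ℝ w x} := by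
      ext x
      change f x = true ↔ -w₀ < inner ℝ w x
      rw [hf x, neg_lt_iff_pos_add]
    exact h ▸ convex_halfSpace_gt hl (-w₀)

lemma linearClassifiers_measurable {f : Plane → Bool} (hf : f ∈ linearClassifiers) :
    Measurable f := by
  obtain ⟨w, w₀, hf⟩ := hf
  refine measurable_to_bool ?_
  have : f ⁻¹' {true} = {x | 0 < inner ℝ w x + w₀} := by
    ext x; exact hf x
  rw [this]
  exact measurableSet_lt measurable_const (by fun_prop)

/-! ### The lattice ball law -/

lemma cond_closedBall_isProbabilityMeasure {r : ℝ} (hr : 0 < r) (c : Plane) :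
    IsProbabilityMeasure (ProbabilityTheory.cond volume (Metric.closedBall c r)) :=
  ProbabilityTheory.cond_isProbabilityMeasure_of_finite
    (Metric.measure_closedBall_pos _ _ hr).ne' measure_closedBall_lt_top.ne

lemma latticeBallLaw_apply (L r : ℝ) (S : Finset (ℤ × ℤ)) (s : Bool) (T : Set LabelledPoint) :
    latticeBallLaw L r S s T = (S.card : ℝ≥0∞)⁻¹ * ∑ a ∈ S,
      (ProbabilityTheory.cond volume (Metric.closedBall (latticePoint L a) r)).map
      (fun x => (x, parityLabel s a)) T := by
  simp [latticeBallLaw, Measure.smul_apply, Measure.finsetSum_apply]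

lemma latticeBallLaw_isProbabilityMeasure {L r : ℝ} (hr : 0 < r) {S : Finset (ℤ × ℤ)}
    (hS : S.Nonempty) (s : Bool) : IsProbabilityMeasure (latticeBallLaw L r S s) := by
  constructor
  rw [latticeBallLaw_apply]
  have h : ∀ a ∈ S, (ProbabilityTheory.cond volume
      (Metric.closedBall (latticePoint L a) r)).map (fun x => (x, parityLabel s a)) Set.univ
      = 1 := by
    intro a _
    have := cond_closedBall_isProbabilityMeasure hr (latticePoint L a)
    rw [Measure.map_apply (by fun_prop) MeasurableSet.univ, Set.preimage_univ, measure_univ]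
  rw [Finset.sum_congr rfl h]
  simp only [Finset.sum_const, nsmul_eq_mul, mul_one]
  exact ENNReal.inv_mul_cancel (by simpa using hS.ne_empty) (by simp)

/-- Almost every labelled point lies in the open ball about a centre and has its label. -/
lemma ae_latticeBallLaw (L r : ℝ) (S : Finset (ℤ × ℤ)) (s : Bool) :
    ∀ᵐ p ∂(latticeBallLaw L r S s),
      ∃ a ∈ S, p.1 ∈ Metric.ball (latticePoint L a) r ∧ p.2 = parityLabel s a := by
  have hm : MeasurableSet {p : LabelledPoint | ∃ a ∈ S,
      p.1 ∈ Metric.ball (latticePoint L a) r ∧ p.2 = parityLabel s a} := by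
    have : {p : LabelledPoint | ∃ a ∈ S,
        p.1 ∈ Metric.ball (latticePoint L a) r ∧ p.2 = parityLabel s a} =
        ⋃ a ∈ S, Metric.ball (latticePoint L a) r ×ˢ {parityLabel s a} := by
      ext p; simp [and_left_comm]
    rw [this]
    exact Finset.measurableSet_biUnion S fun a _ =>
      Metric.isOpen_ball.measurableSet.prod (measurableSet_singleton _)
  rw [ae_iff, latticeBallLaw_apply]
  refine mul_eq_zero_of_right _ (Finset.sum_eq_zero fun a ha => ?_)
  refine (Measure.map_apply (by fun_prop) hm.compl).trans ?_
  have hin : ∀ᵐ x ∂(ProbabilityTheory.cond volume (Metric.closedBall (latticePoint L a) r)),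
      x ∈ Metric.ball (latticePoint L a) r := by
    have h1 := ProbabilityTheory.ae_cond_mem (μ := (volume : Measure Plane))
      (Metric.isClosed_closedBall (x := latticePoint L a) (ε := r)).measurableSet
    have h2 : ∀ᵐ x ∂(ProbabilityTheory.cond volume (Metric.closedBall (latticePoint L a) r)),
        x ∉ Metric.sphere (latticePoint L a) r :=
      ProbabilityTheory.cond_absolutelyContinuous.ae_le
        (measure_eq_zero_iff_ae_notMem.1 (Measure.addHaar_sphere volume _ r))
    filter_upwards [h1, h2] with x hx hx'
    exact lt_of_le_of_ne hx hx'
  refine measure_mono_null (fun x hx => ?_) (ae_iff.1 hin)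
  exact fun hx' => hx ⟨a, ha, hx', rfl⟩

/-- If the balls of the centres in `G` lie in `T`, then `T` has probability at least `|G| / |S|`. -/
lemma card_div_card_le_latticeBallLaw {L r : ℝ} (hr : 0 < r) {S G : Finset (ℤ × ℤ)} (hG : G ⊆ S)
    (s : Bool) {T : Set LabelledPoint}
    (hT : ∀ a ∈ G, ∀ x ∈ Metric.closedBall (latticePoint L a) r, (x, parityLabel s a) ∈ T) :
    (S.card : ℝ≥0∞)⁻¹ * G.card ≤ latticeBallLaw L r S s T := by
  rw [latticeBallLaw_apply]
  gcongr
  calc (G.card : ℝ≥0∞) = ∑ a ∈ G, 1 := by simp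
    _ ≤ ∑ a ∈ G, (ProbabilityTheory.cond volume (Metric.closedBall (latticePoint L a) r)).map
          (fun x => (x, parityLabel s a)) T := by
        refine Finset.sum_le_sum fun a ha => ?_
        refine le_trans ?_ (Measure.le_map_apply (by fun_prop) _)
        rw [← ProbabilityTheory.cond_apply_self (μ := (volume : Measure Plane))
          (Metric.measure_closedBall_pos _ (latticePoint L a) hr).ne'
          measure_closedBall_lt_top.ne]
        exact measure_mono fun x hx => hT a ha x hx
    _ ≤ _ := Finset.sum_le_sum_of_subset hG

/-- With `O` from a countable basis, this makes the samples of each label dense in its balls. -/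
lemma latticeBallLaw_pos {L r : ℝ} {S : Finset (ℤ × ℤ)} {a : ℤ × ℤ} (ha : a ∈ S) (s : Bool)
    {O : Set Plane} (hO : IsOpen O) (hne : (O ∩ Metric.ball (latticePoint L a) r).Nonempty) :
    0 < latticeBallLaw L r S s
      ((O ∩ Metric.ball (latticePoint L a) r) ×ˢ {parityLabel s a}) := by
  have hopen := hO.inter (Metric.isOpen_ball (x := latticePoint L a) (ε := r))
  rw [latticeBallLaw_apply]
  refine ENNReal.mul_pos (by simp) (ne_of_gt ?_)
  refine lt_of_lt_of_le ?_ (Finset.single_le_sum (fun _ _ => zero_le) ha)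
  refine lt_of_lt_of_le ?_ (Measure.le_map_apply (by fun_prop) _)
  rw [ProbabilityTheory.cond_apply Metric.isClosed_closedBall.measurableSet]
  refine ENNReal.mul_pos
    (ENNReal.inv_ne_zero.2 (measure_closedBall_lt_top (μ := volume)).ne) (ne_of_gt ?_)
  refine lt_of_lt_of_le (hopen.measure_pos volume hne) (measure_mono fun x hx => ?_)
  exact ⟨Metric.ball_subset_closedBall hx.2, hx, rfl⟩

/-! ### Vanishing natural error -/

/-- Almost surely, the natural errors of linear classifiers that fit the first `m` terms of an
i.i.d. sequence tend to zero. -/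
lemma ae_tendsto_naturalError_zero (L r : ℝ) (S : Finset (ℤ × ℤ)) (s : Bool)
    [IsProbabilityMeasure (latticeBallLaw L r S s)] :
    ∀ᵐ ω ∂(Measure.infinitePi fun _ : ℕ => latticeBallLaw L r S s),
      ∀ f : ℕ → Plane → Bool, (∀ m, f m ∈ linearClassifiers ∧ PerfectlyFits m ω (f m)) →
        Tendsto (fun m => naturalError (latticeBallLaw L r S s) (f m)) atTop (𝓝 0) := by
  have hvisit : ∀ᵐ ω ∂(Measure.infinitePi fun _ : ℕ => latticeBallLaw L r S s),
      ∀ O ∈ TopologicalSpace.countableBasis Plane, ∀ a ∈ S,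
        (O ∩ Metric.ball (latticePoint L a) r).Nonempty →
        ∃ i, ω i ∈ (O ∩ Metric.ball (latticePoint L a) r) ×ˢ {parityLabel s a} := by
    rw [ae_ball_iff (TopologicalSpace.countable_countableBasis _)]
    intro O hO
    refine (ae_ball_iff S.countable_toSet).2 ?_
    intro a ha
    rw [ae_all_iff]
    intro hne
    have hopen := TopologicalSpace.isOpen_of_mem_countableBasis hO
    exact ae_exists_mem_infinitePi _
      ((hopen.inter Metric.isOpen_ball).measurableSet.prod (measurableSet_singleton _))
      (latticeBallLaw_pos ha s hopen hne)
  filter_upwards [hvisit] with ω hω f hf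
  have hlim : ∀ᵐ p ∂(latticeBallLaw L r S s), ∀ᶠ m in atTop,
      (p ∈ {p : LabelledPoint | f m p.1 ≠ p.2} ↔ p ∈ (∅ : Set LabelledPoint)) := by
    filter_upwards [ae_latticeBallLaw L r S s] with p ⟨a, ha, hpa, hlab⟩
    have hdense : Metric.ball (latticePoint L a) r ⊆
        closure {x | ∃ i, ω i = (x, parityLabel s a)} := by
      intro x hx
      rw [(TopologicalSpace.isBasis_countableBasis Plane).mem_closure_iff]
      intro O hO hxO
      obtain ⟨i, hi⟩ := hω O hO a ha ⟨x, hxO, hx⟩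
      exact ⟨(ω i).1, hi.1.1, i, Prod.ext rfl hi.2⟩
    have hhull := Metric.isOpen_ball.subset_convexHull_of_subset_closure hdense hpa
    -- Finitely many samples already enclose the point, so they all occur before some finite time.
    rw [convexHull_eq_union_convexHull_finite_subsets] at hhull
    simp only [Set.mem_iUnion] at hhull
    obtain ⟨t, ht, hpt⟩ := hhull
    have hev : ∀ᶠ m in atTop, ∀ x ∈ t, f m x = parityLabel s a := by
      rw [eventually_all_finset]
      intro x hx
      obtain ⟨i, hi⟩ := ht hx
      filter_upwards [eventually_gt_atTop i] with m hm
      simpa [hi] using (hf m).2 i hm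
    filter_upwards [hev] with m hm
    have := convexHull_min (fun x hx => hm x hx)
      (linearClassifiers_convex (hf m).1 (parityLabel s a)) hpt
    change f m p.1 = parityLabel s a at this
    simp [this, hlab]
  have h := tendsto_measure_of_ae_tendsto_indicator_of_isFiniteMeasure atTop MeasurableSet.empty
    (fun m => (measurableSet_eq_fun
      ((linearClassifiers_measurable (hf m).1).comp measurable_fst) measurable_snd).compl) hlim
  rw [measure_empty] at h
  exact (ENNReal.tendsto_toReal ENNReal.zero_ne_top).comp h

/-! ### The thin strip -/

/-- The `k` centres `(qj, -j)` and the `k` centres `(qj + 1, -j)`, which lie on the neighbouring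
lattice lines `a + qb = 0` and `a + qb = 1`. -/
def stripCentres (q : ℤ) (k : ℕ) : Finset (ℤ × ℤ) :=
  (Finset.range k).image (fun j : ℕ => (q * j, -(j : ℤ))) ∪
    (Finset.range k).image (fun j : ℕ => (q * j + 1, -(j : ℤ)))

lemma mem_stripCentres {q : ℤ} {k : ℕ} {a : ℤ × ℤ} :
    a ∈ stripCentres q k ↔
      ∃ j < k, a = (q * j, -(j : ℤ)) ∨ a = (q * j + 1, -(j : ℤ)) := by
  simp only [stripCentres, Finset.mem_union, Finset.mem_image, Finset.mem_range]
  constructor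
  · rintro (⟨j, hj, rfl⟩ | ⟨j, hj, rfl⟩)
    exacts [⟨j, hj, Or.inl rfl⟩, ⟨j, hj, Or.inr rfl⟩]
  · rintro ⟨j, hj, rfl | rfl⟩
    exacts [Or.inl ⟨j, hj, rfl⟩, Or.inr ⟨j, hj, rfl⟩]

lemma even_strip {q : ℤ} (hq : Odd q) (j : ℤ) : Even (q * j + -j) := by
  obtain ⟨n, rfl⟩ := hq
  exact ⟨n * j, by ring⟩

lemma odd_strip {q : ℤ} (hq : Odd q) (j : ℤ) : Odd (q * j + 1 + -j) := by
  obtain ⟨n, rfl⟩ := hq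
  exact ⟨n * j, by ring⟩

lemma parityLabel_even_strip {q : ℤ} (hq : Odd q) (s : Bool) (j : ℤ) :
    parityLabel s (q * j, -j) = s := by
  simp [parityLabel, Int.not_odd_iff_even.2 (even_strip hq j)]

lemma parityLabel_odd_strip {q : ℤ} (hq : Odd q) (s : Bool) (j : ℤ) :
    parityLabel s (q * j + 1, -j) = !s := by
  simp [parityLabel, odd_strip hq j]

lemma card_filter_even_stripCentres {q : ℤ} (hq : Odd q) (k : ℕ) :
    ((stripCentres q k).filter (fun a => Even (a.1 + a.2))).card = k := by
  rw [stripCentres, Finset.filter_union, Finset.filter_true_of_mem, Finset.filter_false_of_mem,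
    Finset.union_empty, Finset.card_image_of_injective, Finset.card_range]
  · intro i j h
    simpa using congrArg Prod.snd h
  · simp only [Finset.mem_image]
    rintro _ ⟨j, _, rfl⟩
    exact Int.not_even_iff_odd.2 (odd_strip hq j)
  · simp only [Finset.mem_image]
    rintro _ ⟨j, _, rfl⟩
    exact even_strip hq j

lemma card_filter_odd_stripCentres {q : ℤ} (hq : Odd q) (k : ℕ) :
    ((stripCentres q k).filter (fun a => Odd (a.1 + a.2))).card = k := by
  rw [stripCentres, Finset.filter_union, Finset.filter_false_of_mem, Finset.filter_true_of_mem,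
    Finset.empty_union, Finset.card_image_of_injective, Finset.card_range]
  · intro i j h
    simpa using congrArg Prod.snd h
  · simp only [Finset.mem_image]
    rintro _ ⟨j, _, rfl⟩
    exact odd_strip hq j
  · simp only [Finset.mem_image]
    rintro _ ⟨j, _, rfl⟩
    exact Int.not_odd_iff_even.2 (even_strip hq j)

lemma card_stripCentres {q : ℤ} (hq : Odd q) (k : ℕ) : (stripCentres q k).card = 2 * k := by
  rw [← Finset.card_filter_add_card_filter_not (fun a : ℤ × ℤ => Even (a.1 + a.2)),
    card_filter_even_stripCentres hq]
  simp only [Int.not_even_iff_odd]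
  rw [card_filter_odd_stripCentres hq, two_mul]

lemma abs_coord_sub_le_dist (x y : Plane) (i : Fin 2) : |x i - y i| ≤ dist x y := by
  rw [dist_eq_norm]
  exact PiLp.norm_apply_le (x - y) i

/-- The line `x₀ + q x₁ = 2` separates the balls of radius `1 / q` about the even and the odd
centres of the strip. -/
lemma strip_separated {q : ℤ} (hq : Odd q) (hq5 : 5 ≤ q) {k : ℕ} (s : Bool) {a : ℤ × ℤ}
    (ha : a ∈ stripCentres q k) {x : Plane} (hx : x ∈ Metric.ball (latticePoint 4 a) (1 / q)) :
    0 < labelSign (parityLabel s a) *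
      (inner ℝ (!₂[-labelSign s, -labelSign s * q] : Plane) x + 2 * labelSign s) := by
  have hq' : (5 : ℝ) ≤ q := by exact_mod_cast hq5
  have hr : 1 / (q : ℝ) ≤ 1 / 5 := by gcongr
  have hqr : (q : ℝ) * (1 / q) = 1 := by field_simp
  have h0 := (abs_coord_sub_le_dist x (latticePoint 4 a) 0).trans_lt hx
  have h1 := (abs_coord_sub_le_dist x (latticePoint 4 a) 1).trans_lt hx
  simp only [latticePoint] at h0 h1
  have hin : inner ℝ (!₂[-labelSign s, -labelSign s * q] : Plane) x =
      -labelSign s * (x 0 + q * x 1) := by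
    simp [PiLp.inner_apply, Fin.sum_univ_two]; ring
  rw [hin]
  simp only [Matrix.cons_val_zero, Matrix.cons_val_one] at h0 h1
  rw [abs_lt] at h0 h1
  have hs : labelSign s * labelSign s = 1 := by cases s <;> simp [labelSign]
  have hs' : labelSign (!s) = -labelSign s := by cases s <;> simp [labelSign]
  -- `x₀ + q x₁` is 0 or 4 at a centre and varies by less than `(1 + q) / q < 2` on its ball.
  obtain ⟨j, _, rfl | rfl⟩ := mem_stripCentres.1 ha
  · rw [parityLabel_even_strip hq]
    push_cast at h0 h1
    have e : labelSign s * (-labelSign s * (x 0 + q * x 1) + 2 * labelSign s) =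
        (labelSign s * labelSign s) * (2 - (x 0 + q * x 1)) := by ring
    rw [e, hs]
    nlinarith
  · rw [parityLabel_odd_strip hq, hs']
    push_cast at h0 h1
    have e : -labelSign s * (-labelSign s * (x 0 + q * x 1) + 2 * labelSign s) =
        (labelSign s * labelSign s) * (x 0 + q * x 1 - 2) := by ring
    rw [e, hs]
    nlinarith

/-- One of three neighbouring centres is within `2 / q` of a point where a given linear classifier
disagrees with the label of that centre. -/
lemma exists_strip_near_error {q : ℤ} (hq : Odd q) (hq5 : 5 ≤ q) (s : Bool) {f : Plane → Bool}
    (hf : f ∈ linearClassifiers) (j : ℤ) :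
    ∃ a : ℤ × ℤ, (a = (q * j, -j) ∨ a = (q * (j + 1), -(j + 1)) ∨ a = (q * j + 1, -j)) ∧
      ∃ z, dist z (latticePoint 4 a) ≤ 2 / q ∧ f z ≠ parityLabel s a := by
  have hq' : (5 : ℝ) ≤ q := by exact_mod_cast hq5
  have hv : ‖(!₂[0, 2 / (q : ℝ)] : Plane)‖ = 2 / q := by
    rw [EuclideanSpace.norm_eq, Fin.sum_univ_two]
    simp only [Matrix.cons_val_zero, Matrix.cons_val_one, norm_zero,
      Real.norm_eq_abs, sq_abs]
    rw [zero_pow two_ne_zero, zero_add, Real.sqrt_sq (by positivity)]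
  set v : Plane := !₂[0, 2 / (q : ℝ)] with hvdef
  by_contra! hcon
  have hA := hcon _ (Or.inl rfl) (latticePoint 4 (q * j, -j) + v) (by simp [hv])
  have hA' := hcon _ (Or.inr (Or.inl rfl)) (latticePoint 4 (q * (j + 1), -(j + 1)) + v)
    (by simp [hv])
  have hB := hcon _ (Or.inr (Or.inr rfl)) (latticePoint 4 (q * j + 1, -j) - v)
    (by simp [hv])
  rw [parityLabel_even_strip hq] at hA hA'
  rw [parityLabel_odd_strip hq] at hB
  have hq1 : 0 ≤ 1 - 1 / (q : ℝ) := by rw [sub_nonneg, div_le_one] <;> linarith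
  have hq0 : 0 ≤ 1 / (q : ℝ) := by positivity
  have hconv := convex_iff_add_mem.1 (linearClassifiers_convex hf s) hA hA' hq1 hq0 (by ring)
  have hmid : (1 - 1 / (q : ℝ)) • (latticePoint 4 (q * j, -j) + v) +
      (1 / (q : ℝ)) • (latticePoint 4 (q * (j + 1), -(j + 1)) + v) =
      latticePoint 4 (q * j + 1, -j) - v := by
    ext i
    fin_cases i <;> simp [latticePoint, hvdef] <;> field_simp <;> ring
  rw [hmid] at hconv
  have hconv' : f (latticePoint 4 (q * j + 1, -j) - v) = s := hconv
  rw [hB] at hconv'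
  cases s <;> simp at hconv'

/-- Every linear classifier has adversarial error at least `1 / 8` on the strip. -/
lemma le_adversarialError_strip {q : ℤ} (hq : Odd q) (hq5 : 5 ≤ q) {k : ℕ} (hk : 2 ≤ k)
    (s : Bool) {f : Plane → Bool} (hf : f ∈ linearClassifiers) {γ : ℝ} (hγ : 3 / (q : ℝ) ≤ γ) :
    1 / 8 ≤ adversarialError γ (latticeBallLaw 4 (1 / q) (stripCentres q k) s) f := by
  classical
  have hq' : (5 : ℝ) ≤ q := by exact_mod_cast hq5
  have hr : (0 : ℝ) < 1 / q := by positivity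
  have hcard := card_stripCentres hq k
  have hne : (stripCentres q k).Nonempty := by
    rw [← Finset.card_pos]; omega
  have := latticeBallLaw_isProbabilityMeasure (L := 4) hr hne s
  set T : Set LabelledPoint := {p | ∃ z ∈ Metric.closedBall p.1 γ, f z ≠ p.2} with hT
  set G := (stripCentres q k).filter
    (fun a => ∃ z, dist z (latticePoint 4 a) ≤ 2 / q ∧ f z ≠ parityLabel s a) with hG
  have hGT : ∀ a ∈ G, ∀ x ∈ Metric.closedBall (latticePoint 4 a) (1 / (q : ℝ)),
      (x, parityLabel s a) ∈ T := by
    intro a ha x hx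
    obtain ⟨z, hz, hfz⟩ := (Finset.mem_filter.1 ha).2
    refine ⟨z, ?_, hfz⟩
    rw [Metric.mem_closedBall] at hx ⊢
    calc dist z x ≤ dist z (latticePoint 4 a) + dist x (latticePoint 4 a) :=
          dist_triangle_right _ _ _
      _ ≤ 2 / q + 1 / q := add_le_add hz hx
      _ = 3 / q := by ring
      _ ≤ γ := hγ
  have hGcard : k / 2 ≤ G.card := by
    -- The triples starting at even `j = 2i` are disjoint; halving the row number recovers `i`.
    have hsub : Finset.range (k / 2) ⊆ G.image (fun a => (-a.2).toNat / 2) := by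
      intro i hi
      rw [Finset.mem_range] at hi
      obtain ⟨a, ha, hz⟩ := exists_strip_near_error hq hq5 s hf ((2 * i : ℕ) : ℤ)
      refine Finset.mem_image.2 ⟨a, Finset.mem_filter.2 ⟨mem_stripCentres.2 ?_, hz⟩, ?_⟩
      · rcases ha with rfl | rfl | rfl
        · exact ⟨2 * i, by omega, Or.inl rfl⟩
        · exact ⟨2 * i + 1, by omega, Or.inl (by push_cast; rfl)⟩
        · exact ⟨2 * i, by omega, Or.inr rfl⟩
      · rcases ha with rfl | rfl | rfl <;> dsimp only <;> omega
    simpa using (Finset.card_le_card hsub).trans Finset.card_image_le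
  have hle := card_div_card_le_latticeBallLaw hr (Finset.filter_subset _ _) s hGT
  have hreal := ENNReal.toReal_mono (measure_ne_top _ _) hle
  rw [ENNReal.toReal_mul, ENNReal.toReal_inv, ENNReal.toReal_natCast, ENNReal.toReal_natCast,
    hcard] at hreal
  refine le_trans ?_ hreal
  -- Rounding down in `k / 2` costs at most another factor 2, since `k ≥ 2`.
  have hG4 : k ≤ 4 * G.card := by omega
  have hG4' : (k : ℝ) ≤ 4 * G.card := by exact_mod_cast hG4
  have hk' : (0 : ℝ) < k := by exact_mod_cast (by omega : 0 < k)
  push_cast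
  rw [inv_mul_eq_div, div_le_div_iff₀ (by norm_num) (by positivity)]
  linarith

/-! ### Parity classifiers -/

/-- The parity classifiers are constant on the open balls of radius `2` about lattice points. -/
lemma parity_round_eq {a : ℤ × ℤ} {z : Plane} (hz : dist z (latticePoint 4 a) < 2) :
    (round (z 0 / 4), round (z 1 / 4)) = a := by
  have h0 := (abs_coord_sub_le_dist z (latticePoint 4 a) 0).trans_lt hz
  have h1 := (abs_coord_sub_le_dist z (latticePoint 4 a) 1).trans_lt hz
  simp only [latticePoint, Matrix.cons_val_zero, Matrix.cons_val_one] at h0 h1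
  rw [abs_lt] at h0 h1
  refine Prod.ext (round_eq_iff.2 ⟨?_, ?_⟩) (round_eq_iff.2 ⟨?_, ?_⟩) <;> linarith

/-- A parity classifier with the sign of the labels has zero error, also against adversaries. -/
lemma errors_parity_eq_zero {r : ℝ} (S : Finset (ℤ × ℤ)) (s : Bool) {h : Plane → Bool}
    (hh : ∀ x, h x = parityLabel s (round (x 0 / 4), round (x 1 / 4))) {R : ℝ} (hR : 0 ≤ R)
    (hrR : r + R ≤ 2) :
    naturalError (latticeBallLaw 4 r S s) h = 0 ∧
      ∀ γ ∈ Set.Icc 0 R, adversarialError γ (latticeBallLaw 4 r S s) h = 0 := by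
  have key : ∀ γ ≤ R, adversarialError γ (latticeBallLaw 4 r S s) h = 0 := by
    intro γ hγ
    rw [adversarialError, measureReal_def, measure_mono_null ?_
      (ae_iff.1 (ae_latticeBallLaw 4 r S s)), ENNReal.toReal_zero]
    rintro p ⟨z, hz, hne⟩ ⟨a, _, hpa, hlab⟩
    refine hne ?_
    rw [hh, parity_round_eq (a := a), hlab]
    rw [Metric.mem_closedBall] at hz
    rw [Metric.mem_ball] at hpa
    linarith [dist_triangle z p.1 (latticePoint 4 a)]
  refine ⟨?_, fun γ hγ => key γ hγ.2⟩
  -- The natural error is the adversarial error of radius 0.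
  have h0 := key 0 hR
  simpa [adversarialError, naturalError, Metric.closedBall_zero] using h0

/-! ### Assembly -/

theorem mainTheorem4 :
    ∃ c : ℝ, 0 < c ∧ ∀ γ₀ : ℝ, 0 < γ₀ → γ₀ < 1 / Real.sqrt 2 →
      ∃ (L r : ℝ) (D : ℕ → Bool → ProbabilityMeasure LabelledPoint),
        0 < r ∧ r < L / 2 ∧
        ∀ k : ℕ, 2 ≤ k → ∀ s : Bool,
          IsLatticeParityLaw L r k s (D k s) ∧
          -- (i) linear classifiers
          (∀ᵐ ω ∂(iidLaw (D k s)),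
            (∀ m : ℕ, LinearlySeparable m ω) ∧
            (∀ m : ℕ, ∀ f ∈ linearClassifiers, PerfectlyFits m ω f →
              ∀ γ : ℝ, γ₀ < γ → 0.0005 ≤ adversarialError γ (D k s) f) ∧
            (∀ f : ℕ → Plane → Bool,
              (∀ m, f m ∈ linearClassifiers ∧ PerfectlyFits m ω (f m)) →
              Tendsto (fun m => naturalError (D k s) (f m)) atTop (𝓝 0))) ∧
          -- (ii) parity classifiers
          (∀ᵐ ω ∂(iidLaw (D k s)), ∀ m : ℕ, ∃ h ∈ parityClassifiers L, PerfectlyFits m ω h) ∧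
          (∀ δ : ℝ, 0 < δ → δ < 1 → ∀ m : ℕ, c * Real.log (1 / δ) ≤ m →
            iidLaw (D k s) {ω | ∃ h ∈ parityClassifiers L, PerfectlyFits m ω h ∧
              ¬ (naturalError (D k s) h = 0 ∧
                ∀ γ ∈ Set.Icc 0 (γ₀ + 1 / 8), adversarialError γ (D k s) h = 0)}
              ≤ ENNReal.ofReal δ) := by
  refine ⟨1, one_pos, fun γ₀ hγ₀ hγ₀' => ?_⟩
  have hγ1 : γ₀ < 1 := hγ₀'.trans_le
    ((div_le_one (by positivity)).2 (Real.one_le_sqrt.2 (by norm_num)))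
  obtain ⟨n, hn⟩ := exists_nat_gt (3 / γ₀)
  obtain ⟨q, hq, hq5, hqγ⟩ : ∃ q : ℤ, Odd q ∧ 5 ≤ q ∧ 3 / (q : ℝ) ≤ γ₀ := by
    refine ⟨2 * (n + 2) + 1, ⟨n + 2, rfl⟩, by omega, ?_⟩
    push_cast
    rw [div_le_iff₀ (by positivity)]
    rw [div_lt_iff₀ hγ₀] at hn
    nlinarith [(Nat.cast_nonneg n : (0 : ℝ) ≤ n)]
  have hq' : (5 : ℝ) ≤ q := by exact_mod_cast hq5
  have hr : (0 : ℝ) < 1 / q := by positivity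
  have hr5 : 1 / (q : ℝ) ≤ 1 / 5 := by gcongr
  have hprob : ∀ k : ℕ, 0 < k → ∀ s : Bool,
      IsProbabilityMeasure (latticeBallLaw 4 (1 / q) (stripCentres q k) s) := by
    intro k hk s
    refine latticeBallLaw_isProbabilityMeasure hr ?_ s
    rw [← Finset.card_pos, card_stripCentres hq]; omega
  obtain ⟨D, hD⟩ : ∃ D : ℕ → Bool → ProbabilityMeasure LabelledPoint, ∀ k, 0 < k → ∀ s,
      (D k s : Measure LabelledPoint) = latticeBallLaw 4 (1 / q) (stripCentres q k) s :=
    -- With `k = 0` there are no centres, so an arbitrary point mass fills in.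
    ⟨fun k s => if hk : 0 < k then ⟨_, hprob k hk s⟩ else
      ⟨Measure.dirac (0, false), inferInstance⟩, fun k hk s => by simp [hk]⟩
  refine ⟨4, 1 / q, D, hr, by linarith, fun k hk s => ?_⟩
  have hk0 : 0 < k := by omega
  have := hprob k hk0 s
  simp only [iidLaw, hD k hk0 s]
  set P := latticeBallLaw 4 (1 / q) (stripCentres q k) s
  have hgood := ae_forall_infinitePi P (ae_latticeBallLaw 4 (1 / q) (stripCentres q k) s)
  have hlabel : ∀ t : Bool, ∀ h : Plane → Bool,
      (∀ x, h x = parityLabel t (round (x 0 / 4), round (x 1 / 4))) → ∀ x a,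
      x ∈ Metric.ball (latticePoint 4 a) (1 / (q : ℝ)) → h x = parityLabel t a := by
    intro t h hh x a hx
    rw [Metric.mem_ball] at hx
    rw [hh, parity_round_eq (a := a) (by linarith)]
  refine ⟨⟨_, card_filter_even_stripCentres hq k, card_filter_odd_stripCentres hq k, rfl⟩,
    ?_, ?_, ?_⟩
  · filter_upwards [hgood, ae_tendsto_naturalError_zero 4 (1 / q) (stripCentres q k) s]
      with ω hω hlim
    refine ⟨fun m => ⟨!₂[-labelSign s, -labelSign s * q], 2 * labelSign s, fun i _ => ?_⟩,
      fun m f hf _ γ hγ => ?_, hlim⟩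
    · obtain ⟨a, ha, hx, hlab⟩ := hω i
      rw [hlab]
      exact strip_separated hq hq5 s ha hx
    · refine le_trans (by norm_num)
        (le_adversarialError_strip hq hq5 hk s hf (hqγ.trans hγ.le))
  · filter_upwards [hgood] with ω hω m
    refine ⟨_, ⟨s, fun x => rfl⟩, fun i _ => ?_⟩
    obtain ⟨a, _, hx, hlab⟩ := hω i
    rw [hlab]
    exact hlabel s _ (fun _ => rfl) _ a hx
  · intro δ hδ hδ1 m hm
    -- Only `m ≥ 1` is needed, so `c = 1` works: the bad event is null after a single sample.
    have hm0 : 0 < m := by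
      have hlog : 0 < Real.log (1 / δ) := Real.log_pos (by rwa [lt_div_iff₀ hδ, one_mul])
      exact_mod_cast (by linarith : (0 : ℝ) < m)
    refine (le_of_eq (measure_mono_null ?_ (ae_iff.1 hgood))).trans zero_le
    rintro ω ⟨h, ⟨t, hh⟩, hfit, hbad⟩ hω
    refine hbad ?_
    obtain ⟨a, _, hx, hlab⟩ := hω 0
    have hts : parityLabel t a = parityLabel s a := by
      rw [← hlab, ← hfit 0 hm0, hlabel t h hh _ a hx]
    obtain rfl : t = s := by simpa [parityLabel] using hts
    exact errors_parity_eq_zero _ _ hh (by linarith) (by linarith)
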